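/- Let $0\le x\le 1$ and let $\Lambda_x$ be the qutrit channel on complex $3\times 3$ matrices $$\Lambda_x(\rho)=(1-x)\rho+\frac{x}{2}\bigl(\mathrm{Tr}(\rho)\,I-\rho^{T}\bigr).$$ Write $S(\rho)=-\mathrm{Tr}(\rho\log_2\rho)$ for the von Neumann entropy (with $0\log_2 0=0$). A map $\Lambda^c$ from $3\times3$ matrices to the matrices over a finite-dimensional environment $E$ is a complementary channel of $\Lambda_x$ if there is an isometry $V:\mathbb C^3\to\mathbb C^3\otimes E$ with $\Lambda_x(\rho)=\mathrm{tr}_E(V\rho V^\dagger)$ and $\Lambda^c(\rho)=\mathrm{tr}_{\mathbb C^3}(V\rho V^\dagger)$ for all $\rho$. Let $K_0=\sqrt{1-x}\,I$ and $K_a=\sqrt{x/2}\,J_a$ for $a=1,2,3$, where $(J_a)_{bc}=-i\,\epsilon_{abc}$ are the spin-1 matrices, and let $(R_i)_{\alpha j}=(K_\alpha)_{ij}$. Then $\Lambda_x^c(\rho)=\sum_{i=1}^{3}R_i\rho R_i^\dagger$ is a complementary channel of $\Lambda_x$. Moreover, for every complementary channel $\Lambda^c$ of $\Lambda_x$, the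 entanglement-assisted classical capacity $$C_{ea}(\Lambda_x)=\max_{\rho}\bigl[S(\rho)+S(\Lambda_x(\rho))-S(\Lambda^c(\rho))\bigr],$$ the maximum being over all $3\times 3$ density matrices, is attained at $\rho=I/3$, and $$C_{ea}(\Lambda_x)=2\log_2 3+x\log_2\frac{x}{3}+(1-x)\log_2(1-x).$$ -/

import Mathlib

open scoped Matrix ComplexOrder

noncomputable section

namespace QChannel

/-- Density matrices: positive semidefinite matrices of unit trace. -/
def IsDensityMatrix {A : Type*} [Fintype A] (ρ : Matrix A A ℂ) : Prop :=
  ρ.PosSemidef ∧ ρ.trace = 1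

/-- The von Neumann entropy `S(ρ) = -Tr(ρ log₂ ρ)`; the logarithm of a Hermitian matrix is taken
by functional calculus. As `Real.logb 2 0 = 0`, the kernel of `ρ` contributes `0`
(the convention `0 log 0 = 0`). -/
def vonNeumannEntropy {A : Type*} [Fintype A] [DecidableEq A] (ρ : Matrix A A ℂ) : ℝ :=
  -(ρ * cfc (Real.logb 2) ρ).trace.re

/-- Partial trace over the second factor. -/
def partialTraceRight {B E : Type*} [Fintype E] (M : Matrix (B × E) (B × E) ℂ) : Matrix B B ℂ :=
  Matrix.of fun i j => ∑ e, M (i, e) (j, e)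

/-- Partial trace over the first factor. -/
def partialTraceLeft {B E : Type*} [Fintype B] (M : Matrix (B × E) (B × E) ℂ) : Matrix E E ℂ :=
  Matrix.of fun a b => ∑ i, M (i, a) (i, b)

/-- `Φc` is a complementary channel of `Φ`: for some Stinespring isometry `V : A → B ⊗ E`,
`Φ(ρ) = tr_E (V ρ V†)` and `Φc(ρ) = tr_B (V ρ V†)`. -/
def IsComplementaryChannel {A B E : Type*} [Fintype A] [DecidableEq A] [Fintype B] [Fintype E]
    (Φ : Matrix A A ℂ → Matrix B B ℂ) (Φc : Matrix A A ℂ → Matrix E E ℂ) : Prop :=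
  ∃ V : Matrix (B × E) A ℂ, Vᴴ * V = 1 ∧
    (∀ ρ, Φ ρ = partialTraceRight (V * ρ * Vᴴ)) ∧
    (∀ ρ, Φc ρ = partialTraceLeft (V * ρ * Vᴴ))

/-- The mutual information `I(ρ, Φ) = S(ρ) + S(Φ(ρ)) - S(Φc(ρ))`, where `Φc` is a complementary
channel of `Φ`. -/
def mutualInformation {A B E : Type*} [Fintype A] [DecidableEq A] [Fintype B] [DecidableEq B]
    [Fintype E] [DecidableEq E]
    (Φ : Matrix A A ℂ → Matrix B B ℂ) (Φc : Matrix A A ℂ → Matrix E E ℂ)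
    (ρ : Matrix A A ℂ) : ℝ :=
  vonNeumannEntropy ρ + vonNeumannEntropy (Φ ρ) - vonNeumannEntropy (Φc ρ)

/-- The entanglement-assisted classical capacity: the supremum of the mutual information over all
input density matrices. -/
def eaCapacity {A B E : Type*} [Fintype A] [DecidableEq A] [Fintype B] [DecidableEq B]
    [Fintype E] [DecidableEq E]
    (Φ : Matrix A A ℂ → Matrix B B ℂ) (Φc : Matrix A A ℂ → Matrix E E ℂ) : ℝ :=
  sSup (mutualInformation Φ Φc '' {ρ | IsDensityMatrix ρ})

/-- The noisy Landau-Streater (Werner-Holevo) channel on qutrits,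
`Λ_x(ρ) = (1 - x) ρ + (x / 2) (Tr(ρ) I - ρᵀ)`. -/
def noisyLS (x : ℝ) (ρ : Matrix (Fin 3) (Fin 3) ℂ) : Matrix (Fin 3) (Fin 3) ℂ :=
  ((1 - x : ℝ) : ℂ) • ρ + ((x / 2 : ℝ) : ℂ) • (ρ.trace • (1 : Matrix (Fin 3) (Fin 3) ℂ) - ρᵀ)

/-- The Kraus operators of `Λ_x`: `√(1-x) I` and `√(x/2) J_x`, `√(x/2) J_y`, `√(x/2) J_z`, with
the spin-1 angular momentum matrices. -/
def noisyLSKraus (x : ℝ) : Fin 4 → Matrix (Fin 3) (Fin 3) ℂ :=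
  ![((√(1 - x) : ℝ) : ℂ) • (1 : Matrix (Fin 3) (Fin 3) ℂ),
    (-Complex.I * ((√(x / 2) : ℝ) : ℂ)) • !![0, 0, 0; 0, 0, 1; 0, -1, 0],
    (-Complex.I * ((√(x / 2) : ℝ) : ℂ)) • !![0, 0, -1; 0, 0, 0; 1, 0, 0],
    (-Complex.I * ((√(x / 2) : ℝ) : ℂ)) • !![0, 1, 0; -1, 0, 0; 0, 0, 0]]

/-- The map `ρ ↦ ∑ i, R_i ρ R_i†` with `(R_i)_{α,j} = (K_α)_{i,j}`. -/
def krausComplement {A B E : Type*} [Fintype A] [Fintype B]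
    (K : E → Matrix B A ℂ) (ρ : Matrix A A ℂ) : Matrix E E ℂ :=
  ∑ i : B, (Matrix.of fun α j => K α i j) * ρ * (Matrix.of fun α j => K α i j)ᴴ

/-- The complementary channel `Λ_x^c` built from the Kraus operators of `Λ_x`. -/
def noisyLSComplement (x : ℝ) : Matrix (Fin 3) (Fin 3) ℂ → Matrix (Fin 4) (Fin 4) ℂ :=
  krausComplement (noisyLSKraus x)

/-- The maximally mixed qutrit state `I / 3`. -/
def maxMixed : Matrix (Fin 3) (Fin 3) ℂ := (1 / 3 : ℂ) • 1

end QChannel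

end

namespace QChannel

/-! The mutual information splits as `S(Λρ)` plus `S(ρ) - S(Λᶜρ)`, and `I/3` maximises both parts.
The first is at most `log₂ 3` (`vonNeumannEntropy_le_logb_card`), with equality because `Λ` fixes
`I/3`.

For the second, data processing gives `D(Λᶜρ ‖ Λᶜ(I/3)) ≤ D(ρ ‖ I/3) = log₂ 3 - S(ρ)`. Here `Λᶜ(I/3)
= diag(1-x, x/3, x/3, x/3)`, while `Λᶜρ` has diagonal entries `1-x` and `(x/2)(1-ρ_aa)`. Hence
`Tr(Λᶜρ log₂ Λᶜ(I/3)) = (1-x) log₂(1-x) + x log₂(x/3)` for every state `ρ`, and the bound is a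
constant attained at `I/3`.

Data processing (`relativeEntropy_krausMap_le`) comes from integrating over `t > 0` the resolvent
forms `∑ |⟨u_i, v_j⟩|² p_i² / (q_j + t p_i)`. Each is the maximum of a concave quadratic functional,
whose monotonicity is the Kadison-Schwarz inequality.

The choice of complement is immaterial: output states of two complements are `N N†` and `M M†` with
`N† N = M† M`, so they have equal entropy. -/

open scoped MatrixOrder Matrix.Norms.L2Operator in
theorem exists_eq_conjTranspose_mul_self {n : Type*} [Fintype n] [DecidableEq n]
    {A : Matrix n n ℂ} (hA : A.PosSemidef) : ∃ B : Matrix n n ℂ, A = Bᴴ * B :=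
  CStarAlgebra.nonneg_iff_eq_star_mul_self.mp hA.nonneg

/-! ### Entropy as a spectral quantity. -/

section Entropy

variable {n m : Type*} [Fintype n] [DecidableEq n] [Fintype m] [DecidableEq m]

theorem vonNeumannEntropy_eq_sum_eigenvalues {ρ : Matrix n n ℂ} (hρ : ρ.IsHermitian) :
    vonNeumannEntropy ρ = (∑ i, Real.negMulLog (hρ.eigenvalues i)) / Real.log 2 := by
  have hsa : IsSelfAdjoint ρ := hρ
  have hmul : ρ * cfc (Real.logb 2) ρ = cfc (fun t => t * Real.logb 2 t) ρ := by
    have hc (f : ℝ → ℝ) : ContinuousOn f (spectrum ℝ ρ) :=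
      Matrix.finite_real_spectrum.continuousOn f
    rw [cfc_mul (fun t => t) (Real.logb 2) ρ (hc _) (hc _), cfc_id' ℝ ρ hsa]
  rw [vonNeumannEntropy, hmul, hρ.cfc_eq, Matrix.IsHermitian.cfc, Unitary.conjStarAlgAut_apply,
    Matrix.trace_mul_comm, ← mul_assoc]
  simp only [Unitary.coe_star_mul_self, one_mul, Matrix.trace_diagonal, Function.comp_apply]
  rw [Complex.re_sum, ← Finset.sum_neg_distrib, Finset.sum_div]
  refine Finset.sum_congr rfl fun i _ => ?_
  simp only [Real.negMulLog, Real.logb, Complex.coe_algebraMap,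
    Complex.ofReal_re]
  ring

theorem vonNeumannEntropy_eq_sum_roots {ρ : Matrix n n ℂ} (hρ : ρ.IsHermitian) :
    vonNeumannEntropy ρ =
      (ρ.charpoly.roots.map fun z => Real.negMulLog z.re).sum / Real.log 2 := by
  rw [vonNeumannEntropy_eq_sum_eigenvalues hρ, hρ.roots_charpoly_eq_eigenvalues]
  simp [Multiset.map_map]

theorem vonNeumannEntropy_diagonal (d : n → ℝ) :
    vonNeumannEntropy (Matrix.diagonal fun i => (d i : ℂ)) =
      (∑ i, Real.negMulLog (d i)) / Real.log 2 := by
  have h : (Matrix.diagonal fun i => (d i : ℂ)).IsHermitian := by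
    rw [Matrix.isHermitian_diagonal_iff]
    intro i
    simp [isSelfAdjoint_iff]
  rw [vonNeumannEntropy_eq_sum_roots h, Matrix.charpoly_diagonal, Polynomial.roots_prod]
  · simp
  · simp [Finset.prod_ne_zero_iff, Polynomial.X_sub_C_ne_zero]

/-- `N N†` and `N† N` have the same nonzero spectrum, hence the same entropy. -/
theorem vonNeumannEntropy_mul_conjTranspose_self (N : Matrix m n ℂ) :
    vonNeumannEntropy (N * Nᴴ) = vonNeumannEntropy (Nᴴ * N) := by
  rw [vonNeumannEntropy_eq_sum_roots (Matrix.isHermitian_mul_conjTranspose_self N),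
    vonNeumannEntropy_eq_sum_roots (Matrix.isHermitian_conjTranspose_mul_self N)]
  -- The two characteristic polynomials agree up to powers of `X`, whose zero roots contribute
  -- `negMulLog 0 = 0`.
  have h := congrArg Polynomial.roots (Matrix.charpoly_mul_comm' N Nᴴ)
  rw [Polynomial.roots_mul, Polynomial.roots_mul] at h
  · have h2 := congrArg (fun s => (s.map fun z : ℂ => Real.negMulLog z.re).sum) h
    simp only [Polynomial.roots_X_pow, Multiset.map_add, Multiset.sum_add, Multiset.map_nsmul,
      Multiset.sum_nsmul, Multiset.map_singleton, Multiset.sum_singleton, Complex.zero_re,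
      Real.negMulLog_zero, smul_zero, zero_add] at h2
    rw [h2]
  all_goals
    exact mul_ne_zero (pow_ne_zero _ Polynomial.X_ne_zero) (Matrix.charpoly_monic _).ne_zero

theorem IsDensityMatrix.sum_eigenvalues {ρ : Matrix n n ℂ} (hρ : IsDensityMatrix ρ) :
    ∑ i, hρ.1.isHermitian.eigenvalues i = 1 := by
  have h := hρ.1.isHermitian.trace_eq_sum_eigenvalues
  have h2 := congrArg Complex.re (hρ.2.symm.trans h)
  simpa using h2.symm

/-- Jensen's inequality for the concave `negMulLog`, with uniform weights on the eigenvalues. -/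
theorem vonNeumannEntropy_le_logb_card {ρ : Matrix n n ℂ} (hρ : IsDensityMatrix ρ) :
    vonNeumannEntropy ρ ≤ Real.logb 2 (Fintype.card n) := by
  rw [vonNeumannEntropy_eq_sum_eigenvalues hρ.1.isHermitian, Real.logb]
  have hl : 0 < Real.log 2 := Real.log_pos one_lt_two
  refine div_le_div_of_nonneg_right ?_ hl.le
  set p := hρ.1.isHermitian.eigenvalues with hp
  have hsum : ∑ i, p i = 1 := hρ.sum_eigenvalues
  have hne : Nonempty n := by
    by_contra h
    rw [not_nonempty_iff] at h
    simp at hsum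
  have hc : (0 : ℝ) < Fintype.card n := by exact_mod_cast Fintype.card_pos
  have hJ := Real.concaveOn_negMulLog.le_map_sum (t := Finset.univ)
    (w := fun _ : n => (Fintype.card n : ℝ)⁻¹) (p := p) (fun _ _ => by positivity)
    (by simp [hc.ne']) (fun i _ => hρ.1.eigenvalues_nonneg i)
  simp only [smul_eq_mul, ← Finset.mul_sum, hsum, mul_one] at hJ
  rw [Real.negMulLog, Real.log_inv] at hJ
  have := mul_le_mul_of_nonneg_left hJ hc.le
  rw [← mul_assoc, mul_inv_cancel₀ hc.ne', one_mul] at this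
  refine this.trans_eq ?_
  field_simp

end Entropy

/-! ### Independence of the choice of complementary channel. -/

section Complementary

variable {A B E : Type*}

/-- A matrix over `(B × E) × A` rearranged as a matrix over `E × (B × A)`. -/
def environmentMatrix (W : Matrix (B × E) A ℂ) : Matrix E (B × A) ℂ :=
  Matrix.of fun e i => W (i.1, e) i.2

theorem partialTraceLeft_mul_conjTranspose [Fintype A] [Fintype B] (W : Matrix (B × E) A ℂ) :
    partialTraceLeft (W * Wᴴ) = environmentMatrix W * (environmentMatrix W)ᴴ := by
  ext a b
  simp [partialTraceLeft, environmentMatrix, Matrix.mul_apply, Fintype.sum_prod_type]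

/-- Tracing out `E` sums over the row index of `environmentMatrix W`, so its Gram matrix is read off
from the channel on matrix units (a Choi matrix) and does not see the environment. -/
theorem conjTranspose_environmentMatrix_mul [Fintype A] [DecidableEq A] [Fintype E]
    (W : Matrix (B × E) A ℂ) (i k : B × A) :
    ((environmentMatrix W)ᴴ * environmentMatrix W) i k =
      partialTraceRight (W * Matrix.single k.2 i.2 (1 : ℂ) * Wᴴ) k.1 i.1 := by
  rw [Matrix.mul_apply]
  simp only [partialTraceRight, Matrix.of_apply]
  refine Finset.sum_congr rfl fun e _ => ?_
  rw [Matrix.mul_apply, Finset.sum_eq_single i.2]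
  · simp [environmentMatrix, Matrix.conjTranspose_apply, mul_comm]
  · intro j _ hj
    simp [Matrix.mul_single_apply_of_ne, hj]
  · simp

/-- All complementary channels of a channel have the same output entropy. -/
theorem IsComplementaryChannel.vonNeumannEntropy_eq {F : Type*} [Fintype A] [DecidableEq A]
    [Fintype B] [DecidableEq B] [Fintype E] [DecidableEq E] [Fintype F] [DecidableEq F]
    {Φ : Matrix A A ℂ → Matrix B B ℂ} {Φc : Matrix A A ℂ → Matrix E E ℂ}
    {Φd : Matrix A A ℂ → Matrix F F ℂ} (hc : IsComplementaryChannel Φ Φc)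
    (hd : IsComplementaryChannel Φ Φd) {ρ : Matrix A A ℂ} (hρ : ρ.PosSemidef) :
    vonNeumannEntropy (Φc ρ) = vonNeumannEntropy (Φd ρ) := by
  obtain ⟨V, -, hV, hVc⟩ := hc
  obtain ⟨W, -, hW, hWd⟩ := hd
  -- Absorbing `Tᴴ` into the isometries puts both outputs in the form `N Nᴴ`.
  obtain ⟨T, rfl⟩ := exists_eq_conjTranspose_mul_self hρ
  have hV' (M : Matrix A A ℂ) : partialTraceRight (V * Tᴴ * M * (V * Tᴴ)ᴴ) = Φ (Tᴴ * M * T) := by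
    rw [hV, Matrix.conjTranspose_mul, Matrix.conjTranspose_conjTranspose]
    simp only [Matrix.mul_assoc]
  have hW' (M : Matrix A A ℂ) : partialTraceRight (W * Tᴴ * M * (W * Tᴴ)ᴴ) = Φ (Tᴴ * M * T) := by
    rw [hW, Matrix.conjTranspose_mul, Matrix.conjTranspose_conjTranspose]
    simp only [Matrix.mul_assoc]
  have hVT : V * (Tᴴ * T) * Vᴴ = (V * Tᴴ) * (V * Tᴴ)ᴴ := by
    simp [Matrix.conjTranspose_mul, Matrix.mul_assoc]
  have hWT : W * (Tᴴ * T) * Wᴴ = (W * Tᴴ) * (W * Tᴴ)ᴴ := by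
    simp [Matrix.conjTranspose_mul, Matrix.mul_assoc]
  rw [hVc, hWd, hVT, hWT, partialTraceLeft_mul_conjTranspose, partialTraceLeft_mul_conjTranspose,
    vonNeumannEntropy_mul_conjTranspose_self, vonNeumannEntropy_mul_conjTranspose_self]
  congr 1
  ext i k
  rw [conjTranspose_environmentMatrix_mul, conjTranspose_environmentMatrix_mul, hV', hW']

end Complementary

/-! ### From resolvent forms to relative entropy. -/

section Scalar

open Filter Topology

variable {κ ι : Type*} [Fintype κ] [Fintype ι]

theorem hasDerivAt_mul_log_add_mul {w p q t : ℝ} (hp : 0 ≤ p) (hq : 0 ≤ q)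
    (hs : q = 0 → w * p = 0) (ht : 0 ≤ t) :
    HasDerivAt (fun t => w * p * Real.log (q + t * p)) (w * (p ^ 2 / (q + t * p))) t := by
  by_cases h : w * p = 0
  · have h2 : w * (p ^ 2 / (q + t * p)) = 0 := by
      rw [← mul_div_assoc, pow_two, ← mul_assoc, h, zero_mul, zero_div]
    simp only [h, h2, zero_mul]
    exact hasDerivAt_const t 0
  · have hq' : 0 < q := lt_of_le_of_ne hq fun h0 => h (hs h0.symm)
    have hpos : 0 < q + t * p := by positivity
    have h1 : HasDerivAt (fun t => q + t * p) p t := by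
      simpa using ((hasDerivAt_id t).mul_const p).const_add q
    refine ((h1.log hpos.ne').const_mul (w * p)).congr_deriv ?_
    ring

theorem tendsto_mul_log_add_mul_sub {w p q : ℝ} (hp : 0 ≤ p) :
    Tendsto (fun t => w * p * Real.log (q + t * p) - w * p * Real.log t) atTop
      (𝓝 (w * p * Real.log p)) := by
  rcases hp.eq_or_lt with rfl | hp
  · simp
  have h1 : Tendsto (fun t : ℝ => q / t + p) atTop (𝓝 (0 + p)) :=
    (tendsto_const_nhds.div_atTop tendsto_id).add_const p
  rw [zero_add] at h1
  refine ((h1.log hp.ne').const_mul (w * p)).congr' ?_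
  filter_upwards [eventually_gt_atTop 0, h1.eventually_ne hp.ne'] with t ht hne
  rw [show q + t * p = t * (q / t + p) by field_simp, Real.log_mul ht.ne' hne]
  ring

/-- Integrating `∑ w p² / (q + t p)` over `t > 0` yields the relative entropy
`∑ w p (log p - log q)`, up to a term that depends on `∑ w p` only. -/
theorem sum_mul_log_sub_log_le {w p q : κ → ℝ} {w' p' q' : ι → ℝ}
    (hp : ∀ k, 0 ≤ p k) (hq : ∀ k, 0 ≤ q k) (hs : ∀ k, q k = 0 → w k * p k = 0)
    (hp' : ∀ k, 0 ≤ p' k) (hq' : ∀ k, 0 ≤ q' k) (hs' : ∀ k, q' k = 0 → w' k * p' k = 0)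
    (hsum : ∑ k, w' k * p' k = ∑ k, w k * p k)
    (hQ : ∀ t : ℝ, 0 < t →
      ∑ k, w' k * (p' k ^ 2 / (q' k + t * p' k)) ≤ ∑ k, w k * (p k ^ 2 / (q k + t * p k))) :
    ∑ k, w' k * p' k * (Real.log (p' k) - Real.log (q' k)) ≤
      ∑ k, w k * p k * (Real.log (p k) - Real.log (q k)) := by
  -- `F` is a primitive of the resolvent form, so `F - G` is monotone by `hQ`. Its values at `0` and
  -- at infinity carry the `log q` and `log p` sums.
  set F : ℝ → ℝ := fun t => ∑ k, w k * p k * Real.log (q k + t * p k) with hF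
  set G : ℝ → ℝ := fun t => ∑ k, w' k * p' k * Real.log (q' k + t * p' k) with hG
  have hderiv : ∀ t : ℝ, 0 ≤ t → HasDerivAt (fun t => F t - G t)
      (∑ k, w k * (p k ^ 2 / (q k + t * p k)) -
        ∑ k, w' k * (p' k ^ 2 / (q' k + t * p' k))) t := fun t ht =>
    (HasDerivAt.fun_sum fun k _ => hasDerivAt_mul_log_add_mul (hp k) (hq k) (hs k) ht).sub
      (HasDerivAt.fun_sum fun k _ => hasDerivAt_mul_log_add_mul (hp' k) (hq' k) (hs' k) ht)
  have hmono : MonotoneOn (fun t => F t - G t) (Set.Ici 0) := by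
    refine monotoneOn_of_deriv_nonneg (convex_Ici 0)
      (fun t ht => (hderiv t ht).continuousAt.continuousWithinAt) ?_ ?_
    · intro t ht
      rw [interior_Ici] at ht
      exact (hderiv t (le_of_lt ht)).differentiableAt.differentiableWithinAt
    · intro t ht
      rw [interior_Ici] at ht
      rw [(hderiv t (le_of_lt ht)).deriv]
      exact sub_nonneg.mpr (hQ t ht)
  have hlim : Tendsto (fun t => F t - G t) atTop
      (𝓝 (∑ k, w k * p k * Real.log (p k) - ∑ k, w' k * p' k * Real.log (p' k))) := by
    -- Both sums diverge like `log t`, with equal coefficients by `hsum`, so the divergence cancels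
    -- in `F - G`.
    have h1 := (tendsto_finsetSum Finset.univ fun k _ =>
      tendsto_mul_log_add_mul_sub (w := w k) (q := q k) (hp k)).sub
      (tendsto_finsetSum Finset.univ fun k _ =>
        tendsto_mul_log_add_mul_sub (w := w' k) (q := q' k) (hp' k))
    refine h1.congr fun t => ?_
    simp only [Finset.sum_sub_distrib, ← Finset.sum_mul, hsum, hF, hG]
    ring
  have h0 : F 0 - G 0 ≤
      ∑ k, w k * p k * Real.log (p k) - ∑ k, w' k * p' k * Real.log (p' k) := by
    refine ge_of_tendsto hlim ?_
    filter_upwards [eventually_ge_atTop 0] with t ht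
    exact hmono Set.self_mem_Ici ht ht
  simp only [hF, hG, zero_mul, add_zero] at h0
  simp only [mul_sub, Finset.sum_sub_distrib]
  linarith

end Scalar

/-! ### Variational formula and monotonicity of the resolvent forms. -/

section Variational

variable {n m ι : Type*} [Fintype n] [Fintype m] [Fintype ι]

/-- The concave quadratic functional whose maximum over `X` is
`⟨ρ^{1/2}, (L_σ R_ρ⁻¹ + t)⁻¹ ρ^{1/2}⟩`. -/
def resolventFunctional (t : ℝ) (ρ σ X : Matrix n n ℂ) : ℝ :=
  2 * (ρ * X).trace.re - (σ * (X * Xᴴ)).trace.re - t * (ρ * (Xᴴ * X)).trace.re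

/-- The map `ρ ↦ ∑ i, R_i ρ R_i†`. -/
def krausMap (R : ι → Matrix m n ℂ) (ρ : Matrix n n ℂ) : Matrix m m ℂ :=
  ∑ i, R i * ρ * (R i)ᴴ

/-- The adjoint map `X ↦ ∑ i, R_i† X R_i`. -/
def krausAdjoint (R : ι → Matrix m n ℂ) (X : Matrix m m ℂ) : Matrix n n ℂ :=
  ∑ i, (R i)ᴴ * X * R i

theorem trace_krausMap_mul (R : ι → Matrix m n ℂ) (ρ : Matrix n n ℂ) (X : Matrix m m ℂ) :
    (krausMap R ρ * X).trace = (ρ * krausAdjoint R X).trace := by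
  simp only [krausMap, krausAdjoint, Finset.sum_mul, Finset.mul_sum, Matrix.trace_sum]
  refine Finset.sum_congr rfl fun i _ => ?_
  rw [Matrix.mul_assoc, Matrix.mul_assoc, Matrix.trace_mul_comm]
  simp only [Matrix.mul_assoc]

theorem conjTranspose_krausAdjoint {n m ι : Type*} [Fintype m] [Fintype ι] (R : ι → Matrix m n ℂ) (X : Matrix m m ℂ) :
    (krausAdjoint R X)ᴴ = krausAdjoint R Xᴴ := by
  simp [krausAdjoint, Matrix.conjTranspose_sum, Matrix.mul_assoc]

/-- The Kadison-Schwarz inequality for the unital map `krausAdjoint R`. -/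
theorem posSemidef_krausAdjoint_sub [DecidableEq n] (R : ι → Matrix m n ℂ)
    (hR : ∑ i, (R i)ᴴ * R i = 1) (X : Matrix m m ℂ) :
    (krausAdjoint R (Xᴴ * X) - (krausAdjoint R X)ᴴ * krausAdjoint R X).PosSemidef := by
  set Y := krausAdjoint R X with hY
  -- Expanding the squares, both cross terms and, by `hR`, the last term equal `Yᴴ * Y` up to sign.
  have key : krausAdjoint R (Xᴴ * X) - Yᴴ * Y =
      ∑ i, (X * R i - R i * Y)ᴴ * (X * R i - R i * Y) := by
    have h1 : ∑ i, (R i)ᴴ * (Xᴴ * (R i * Y)) = Yᴴ * Y := by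
      rw [show Yᴴ = ∑ i, (R i)ᴴ * Xᴴ * R i from conjTranspose_krausAdjoint R X, Finset.sum_mul]
      simp only [Matrix.mul_assoc]
    have h2 : ∑ i, Yᴴ * ((R i)ᴴ * (X * R i)) = Yᴴ * Y := by
      rw [← Finset.mul_sum, hY]
      simp only [krausAdjoint, Matrix.mul_assoc]
    have h3 : ∑ i, Yᴴ * ((R i)ᴴ * (R i * Y)) = Yᴴ * Y := by
      simp only [← Matrix.mul_assoc (R _)ᴴ]
      rw [← Finset.mul_sum, ← Finset.sum_mul, hR, Matrix.one_mul]
    simp only [Matrix.conjTranspose_sub, Matrix.conjTranspose_mul, Matrix.sub_mul, Matrix.mul_sub,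
      Finset.sum_sub_distrib, Matrix.mul_assoc, h1, h2, h3, krausAdjoint]
    abel
  rw [key]
  exact Matrix.posSemidef_sum _ fun i _ => Matrix.posSemidef_conjTranspose_mul_self _

theorem re_trace_mul_nonneg {A B : Matrix n n ℂ} (hA : A.PosSemidef) (hB : B.PosSemidef) :
    0 ≤ (A * B).trace.re := by
  classical
  obtain ⟨C, rfl⟩ := exists_eq_conjTranspose_mul_self hA
  rw [Matrix.mul_assoc, Matrix.trace_mul_comm]
  exact (Complex.nonneg_iff.mp (hB.mul_mul_conjTranspose_same C).trace_nonneg).1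

/-- By duality the linear term is unchanged. Kadison-Schwarz for `Xᴴ` and for `X` controls the `σ`
and `ρ` quadratic terms respectively. -/
theorem resolventFunctional_krausMap_le [DecidableEq n] (R : ι → Matrix m n ℂ)
    (hR : ∑ i, (R i)ᴴ * R i = 1) {t : ℝ} (ht : 0 ≤ t) {ρ σ : Matrix n n ℂ}
    (hρ : ρ.PosSemidef) (hσ : σ.PosSemidef) (X : Matrix m m ℂ) :
    resolventFunctional t (krausMap R ρ) (krausMap R σ) X ≤
      resolventFunctional t ρ σ (krausAdjoint R X) := by
  have h1 := re_trace_mul_nonneg hρ (posSemidef_krausAdjoint_sub R hR X)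
  have h2 := re_trace_mul_nonneg hσ (posSemidef_krausAdjoint_sub R hR Xᴴ)
  rw [Matrix.mul_sub, Matrix.trace_sub, Complex.sub_re] at h1 h2
  simp only [conjTranspose_krausAdjoint, Matrix.conjTranspose_conjTranspose] at h1 h2
  simp only [resolventFunctional, trace_krausMap_mul, conjTranspose_krausAdjoint]
  have := mul_nonneg ht h1
  linarith

variable [DecidableEq n]

/-- In the two eigenbases the functional decouples into one scalar quadratic per entry of `x`, which
can be maximised separately. -/
theorem resolventFunctional_conj {U V : Matrix n n ℂ} (hU : Uᴴ * U = 1) (hV : Vᴴ * V = 1)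
    (t : ℝ) (p q : n → ℝ) (x : Matrix n n ℂ) :
    resolventFunctional t (U * Matrix.diagonal (fun i => (p i : ℂ)) * Uᴴ)
      (V * Matrix.diagonal (fun i => (q i : ℂ)) * Vᴴ) (V * x * Uᴴ) =
    ∑ k : n × n, (2 * p k.1 * ((Uᴴ * V) k.1 k.2 * x k.2 k.1).re -
      (q k.2 + t * p k.1) * Complex.normSq (x k.2 k.1)) := by
  have e1 : (U * Matrix.diagonal (fun i => (p i : ℂ)) * Uᴴ * (V * x * Uᴴ)).trace =
      (Matrix.diagonal (fun i => (p i : ℂ)) * ((Uᴴ * V) * x)).trace := by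
    rw [Matrix.mul_assoc, Matrix.mul_assoc, Matrix.trace_mul_comm]
    congr 1
    simp only [Matrix.mul_assoc, hU, Matrix.mul_one]
  have e2 : (V * Matrix.diagonal (fun i => (q i : ℂ)) * Vᴴ *
      ((V * x * Uᴴ) * (V * x * Uᴴ)ᴴ)).trace =
      (Matrix.diagonal (fun i => (q i : ℂ)) * (x * xᴴ)).trace := by
    rw [Matrix.mul_assoc, Matrix.mul_assoc, Matrix.trace_mul_comm]
    congr 1
    simp only [Matrix.conjTranspose_mul, Matrix.conjTranspose_conjTranspose, Matrix.mul_assoc]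
    rw [hV, ← Matrix.mul_assoc Uᴴ, hU, ← Matrix.mul_assoc Vᴴ, hV]
    simp
  have e3 : (U * Matrix.diagonal (fun i => (p i : ℂ)) * Uᴴ *
      ((V * x * Uᴴ)ᴴ * (V * x * Uᴴ))).trace =
      (Matrix.diagonal (fun i => (p i : ℂ)) * (xᴴ * x)).trace := by
    rw [Matrix.mul_assoc, Matrix.mul_assoc, Matrix.trace_mul_comm]
    congr 1
    simp only [Matrix.conjTranspose_mul, Matrix.conjTranspose_conjTranspose, Matrix.mul_assoc]
    rw [hU, ← Matrix.mul_assoc Uᴴ, hU, ← Matrix.mul_assoc Vᴴ, hV]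
    simp
  have d (r : n → ℝ) (M : Matrix n n ℂ) :
      (Matrix.diagonal (fun i => (r i : ℂ)) * M).trace.re = ∑ i, r i * (M i i).re := by
    simp [Matrix.trace, Matrix.diagonal_mul]
  rw [resolventFunctional, e1, e2, e3, d, d, d]
  have f1 (i : n) : (x * xᴴ) i i = ((∑ j, Complex.normSq (x i j) : ℝ) : ℂ) := by
    simp [Matrix.mul_apply, Complex.mul_conj]
  have f2 (i : n) : (xᴴ * x) i i = ((∑ j, Complex.normSq (x j i) : ℝ) : ℂ) := by
    simp [Matrix.mul_apply, ← Complex.normSq_eq_conj_mul_self]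
  simp only [f1, f2, Complex.ofReal_re, Matrix.mul_apply (M := Uᴴ * V), Complex.re_sum,
    Finset.mul_sum]
  rw [Finset.sum_comm (f := fun i j => q i * Complex.normSq (x i j)), ← Finset.sum_sub_distrib,
    ← Finset.sum_sub_distrib, Fintype.sum_prod_type]
  refine Finset.sum_congr rfl fun i _ => ?_
  rw [← Finset.sum_sub_distrib, ← Finset.sum_sub_distrib]
  refine Finset.sum_congr rfl fun j _ => ?_
  ring

theorem resolventFunctional_le {U V : Matrix n n ℂ} (hU : Uᴴ * U = 1) (hV : Vᴴ * V = 1)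
    {t : ℝ} (ht : 0 ≤ t) {p q : n → ℝ} (hp : ∀ i, 0 ≤ p i) (hq : ∀ i, 0 < q i)
    (X : Matrix n n ℂ) :
    resolventFunctional t (U * Matrix.diagonal (fun i => (p i : ℂ)) * Uᴴ)
      (V * Matrix.diagonal (fun i => (q i : ℂ)) * Vᴴ) X ≤
    ∑ k : n × n, Complex.normSq ((Uᴴ * V) k.1 k.2) * (p k.1 ^ 2 / (q k.2 + t * p k.1)) := by
  have hX : X = V * (Vᴴ * X * U) * Uᴴ := by
    have hU' : U * Uᴴ = 1 := mul_eq_one_comm.mp hU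
    have hV' : V * Vᴴ = 1 := mul_eq_one_comm.mp hV
    simp only [← Matrix.mul_assoc, hV', Matrix.one_mul]
    rw [Matrix.mul_assoc, hU', Matrix.mul_one]
  rw [hX, resolventFunctional_conj hU hV]
  refine Finset.sum_le_sum fun k _ => ?_
  set c := (Uᴴ * V) k.1 k.2
  set z := (Vᴴ * X * U) k.2 k.1
  have hpos : 0 < q k.2 + t * p k.1 :=
    add_pos_of_pos_of_nonneg (hq _) (mul_nonneg ht (hp _))
  rw [← mul_div_assoc, le_div_iff₀ hpos]
  -- Completing the square: the scalar maximiser is `z = p c̄ / (q + t p)`, also the witness in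
  -- `exists_resolventFunctional_eq`.
  have h := Complex.normSq_nonneg ((p k.1 : ℂ) * (starRingEnd ℂ) c - (q k.2 + t * p k.1 : ℝ) * z)
  rw [Complex.normSq_sub, Complex.normSq_mul, Complex.normSq_mul, Complex.normSq_ofReal,
    Complex.normSq_ofReal, Complex.normSq_conj] at h
  have h2 : ((p k.1 : ℂ) * (starRingEnd ℂ) c *
      (starRingEnd ℂ) ((q k.2 + t * p k.1 : ℝ) * z)).re =
      p k.1 * (q k.2 + t * p k.1) * (c * z).re := by
    rw [show (p k.1 : ℂ) * (starRingEnd ℂ) c * (starRingEnd ℂ) ((q k.2 + t * p k.1 : ℝ) * z) =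
      ((p k.1 * (q k.2 + t * p k.1) : ℝ) : ℂ) * (starRingEnd ℂ) (c * z) by
        simp only [map_mul, Complex.conj_ofReal, Complex.ofReal_mul]; ring,
      Complex.re_ofReal_mul, Complex.conj_re]
  rw [h2] at h
  nlinarith [h]

theorem exists_resolventFunctional_eq {U V : Matrix n n ℂ} (hU : Uᴴ * U = 1) (hV : Vᴴ * V = 1)
    {t : ℝ} (ht : 0 < t) {p q : n → ℝ} (hp : ∀ i, 0 ≤ p i) (hq : ∀ i, 0 ≤ q i) :
    ∃ X, resolventFunctional t (U * Matrix.diagonal (fun i => (p i : ℂ)) * Uᴴ)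
      (V * Matrix.diagonal (fun i => (q i : ℂ)) * Vᴴ) X =
    ∑ k : n × n, Complex.normSq ((Uᴴ * V) k.1 k.2) * (p k.1 ^ 2 / (q k.2 + t * p k.1)) := by
  refine ⟨V * (Matrix.of fun j i => ((p i / (q j + t * p i) : ℝ) : ℂ) *
    (starRingEnd ℂ) ((Uᴴ * V) i j)) * Uᴴ, ?_⟩
  rw [resolventFunctional_conj hU hV]
  refine Finset.sum_congr rfl fun k _ => ?_
  simp only [Matrix.of_apply]
  set c := (Uᴴ * V) k.1 k.2
  rw [show c * (((p k.1 / (q k.2 + t * p k.1) : ℝ) : ℂ) * (starRingEnd ℂ) c) =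
    ((p k.1 / (q k.2 + t * p k.1) * Complex.normSq c : ℝ) : ℂ) by
      rw [Complex.ofReal_mul, ← Complex.mul_conj]; ring,
    Complex.ofReal_re, Complex.normSq_mul, Complex.normSq_conj, Complex.normSq_ofReal]
  -- A vanishing denominator forces `p = 0`, and the convention `0 / 0 = 0` gives the right value.
  by_cases h0 : q k.2 + t * p k.1 = 0
  · have := mul_nonneg ht.le (hp k.1)
    have hp0 : t * p k.1 = 0 := by linarith [hq k.2]
    have : p k.1 = 0 := (mul_eq_zero.mp hp0).resolve_left ht.ne'
    simp [this]
  · field_simp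
    ring

end Variational

/-- Monotonicity of the relative entropy under a Kraus map, in terms of spectral decompositions:
the relative entropy of `U diag(p) U†` and `V diag(q) V†` is
`∑ |⟨u_i, v_j⟩|² p_i (log p_i - log q_j)`. -/
theorem relativeEntropy_krausMap_le {n m ι : Type*} [Fintype n] [DecidableEq n] [Fintype m]
    [DecidableEq m] [Fintype ι] (R : ι → Matrix m n ℂ) (hR : ∑ i, (R i)ᴴ * R i = 1)
    {U V : Matrix n n ℂ} {U' V' : Matrix m m ℂ} (hU : Uᴴ * U = 1) (hV : Vᴴ * V = 1)
    (hU' : U'ᴴ * U' = 1) (hV' : V'ᴴ * V' = 1) {p q : n → ℝ} {p' q' : m → ℝ}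
    (hp : ∀ i, 0 ≤ p i) (hq : ∀ i, 0 < q i) (hp' : ∀ i, 0 ≤ p' i) (hq' : ∀ i, 0 ≤ q' i)
    (hs : ∀ i j, q' j = 0 → Complex.normSq ((U'ᴴ * V') i j) * p' i = 0)
    (hρ : krausMap R (U * Matrix.diagonal (fun i => (p i : ℂ)) * Uᴴ) =
      U' * Matrix.diagonal (fun i => (p' i : ℂ)) * U'ᴴ)
    (hσ : krausMap R (V * Matrix.diagonal (fun i => (q i : ℂ)) * Vᴴ) =
      V' * Matrix.diagonal (fun i => (q' i : ℂ)) * V'ᴴ)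
    (htr : ∑ k : m × m, Complex.normSq ((U'ᴴ * V') k.1 k.2) * p' k.1 =
      ∑ k : n × n, Complex.normSq ((Uᴴ * V) k.1 k.2) * p k.1) :
    ∑ k : m × m, Complex.normSq ((U'ᴴ * V') k.1 k.2) * p' k.1 *
        (Real.log (p' k.1) - Real.log (q' k.2)) ≤
      ∑ k : n × n, Complex.normSq ((Uᴴ * V) k.1 k.2) * p k.1 *
        (Real.log (p k.1) - Real.log (q k.2)) := by
  have psd {r : n → ℝ} (hr : ∀ i, 0 ≤ r i) (W : Matrix n n ℂ) :
      (W * Matrix.diagonal (fun i => (r i : ℂ)) * Wᴴ).PosSemidef :=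
    (Matrix.PosSemidef.diagonal fun i => by simpa using hr i).mul_mul_conjTranspose_same W
  refine sum_mul_log_sub_log_le (w := fun k : n × n => Complex.normSq ((Uᴴ * V) k.1 k.2))
    (p := fun k => p k.1) (q := fun k => q k.2)
    (w' := fun k : m × m => Complex.normSq ((U'ᴴ * V') k.1 k.2))
    (p' := fun k => p' k.1) (q' := fun k => q' k.2) (fun k => hp _) (fun k => (hq _).le)
    (fun k h => absurd h (hq _).ne') (fun k => hp' _) (fun k => hq' _) (fun k => hs _ _) htr
    fun t ht => ?_
  -- The maximiser for the outputs, pulled back by `krausAdjoint R`, is a trial matrix for the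
  -- inputs.
  obtain ⟨X, hX⟩ := exists_resolventFunctional_eq hU' hV' ht hp' hq'
  rw [← hX, ← hρ, ← hσ]
  exact (resolventFunctional_krausMap_le R hR ht.le (psd hp U) (psd (fun i => (hq i).le) V) X).trans
    (resolventFunctional_le hU hV ht.le hp hq _)

/-! ### Spectral decomposition in coordinates. -/

section Spectral

variable {n : Type*} [Fintype n] [DecidableEq n]

theorem eigenvectorUnitary_conjTranspose_mul {M : Matrix n n ℂ} (hM : M.IsHermitian) :
    (hM.eigenvectorUnitary : Matrix n n ℂ)ᴴ * (hM.eigenvectorUnitary : Matrix n n ℂ) = 1 :=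
  Unitary.coe_star_mul_self hM.eigenvectorUnitary

theorem eq_eigenvectorUnitary_mul_diagonal {M : Matrix n n ℂ} (hM : M.IsHermitian) :
    M = (hM.eigenvectorUnitary : Matrix n n ℂ) *
      Matrix.diagonal (fun i => (hM.eigenvalues i : ℂ)) *
        (hM.eigenvectorUnitary : Matrix n n ℂ)ᴴ := by
  conv_lhs => rw [hM.spectral_theorem, Unitary.conjStarAlgAut_apply]
  rfl

theorem apply_self_eq_sum_eigenvalues {M : Matrix n n ℂ} (hM : M.IsHermitian) (j : n) :
    (M j j).re = ∑ i, Complex.normSq ((hM.eigenvectorUnitary : Matrix n n ℂ)ᴴ i j) *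
      hM.eigenvalues i := by
  conv_lhs => rw [eq_eigenvectorUnitary_mul_diagonal hM, Matrix.mul_apply]
  rw [Complex.re_sum]
  refine Finset.sum_congr rfl fun i _ => ?_
  rw [Matrix.mul_diagonal, Matrix.conjTranspose_apply, mul_right_comm, RCLike.star_def,
    Complex.mul_conj, ← Complex.ofReal_mul, Complex.ofReal_re, Complex.normSq_conj]

theorem sum_normSq_eigenvectorUnitary {M : Matrix n n ℂ} (hM : M.IsHermitian) (i : n) :
    ∑ j, Complex.normSq ((hM.eigenvectorUnitary : Matrix n n ℂ)ᴴ i j) = 1 := by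
  have h := congrFun (congrFun (eigenvectorUnitary_conjTranspose_mul hM) i) i
  rw [Matrix.mul_apply, Matrix.one_apply_eq] at h
  have h2 := congrArg Complex.re h
  rw [Complex.re_sum, Complex.one_re] at h2
  rw [← h2]
  refine Finset.sum_congr rfl fun j _ => ?_
  rw [Matrix.conjTranspose_apply, RCLike.star_def, ← Complex.normSq_eq_conj_mul_self,
    Complex.ofReal_re, Complex.normSq_conj]

end Spectral

/-! ### Entropy bound from data processing. -/

section Kraus

variable {n m ι : Type*} [Fintype n] [DecidableEq n] [Fintype m] [DecidableEq m] [Fintype ι]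

theorem krausMap_isDensityMatrix {R : ι → Matrix m n ℂ} (hR : ∑ i, (R i)ᴴ * R i = 1)
    {ρ : Matrix n n ℂ} (hρ : IsDensityMatrix ρ) : IsDensityMatrix (krausMap R ρ) := by
  refine ⟨Matrix.posSemidef_sum _ fun i _ => hρ.1.mul_mul_conjTranspose_same (R i), ?_⟩
  have h := trace_krausMap_mul R ρ 1
  rw [Matrix.mul_one] at h
  rw [h]
  simp only [krausAdjoint, Matrix.mul_one, hR, hρ.2]

/-- Monotonicity of the relative entropy to the maximally mixed state, in terms of entropies. -/
theorem vonNeumannEntropy_sub_krausMap_le {R : ι → Matrix m n ℂ} (hR : ∑ i, (R i)ᴴ * R i = 1)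
    {q : m → ℝ} (hq : ∀ j, 0 ≤ q j)
    (hmix : krausMap R (((Fintype.card n : ℝ)⁻¹ : ℂ) • (1 : Matrix n n ℂ)) =
      Matrix.diagonal fun j => (q j : ℂ))
    {ρ : Matrix n n ℂ} (hρ : IsDensityMatrix ρ)
    (hs : ∀ j, q j = 0 → (krausMap R ρ j j).re = 0) :
    vonNeumannEntropy ρ - vonNeumannEntropy (krausMap R ρ) ≤
      Real.logb 2 (Fintype.card n) + ∑ j, (krausMap R ρ j j).re * Real.logb 2 (q j) := by
  have hΦ := krausMap_isDensityMatrix hR hρ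
  have hH := hρ.1.isHermitian
  have hH' := hΦ.1.isHermitian
  have hl : 0 < Real.log 2 := Real.log_pos one_lt_two
  have hsum : ∑ i, hH.eigenvalues i = 1 := hρ.sum_eigenvalues
  have hsum' : ∑ i, hH'.eigenvalues i = 1 := hΦ.sum_eigenvalues
  have hc : (0 : ℝ) < Fintype.card n := by
    have : Nonempty n := by
      by_contra h
      rw [not_nonempty_iff] at h
      simp at hsum
    exact_mod_cast Fintype.card_pos
  set U := (hH.eigenvectorUnitary : Matrix n n ℂ) with hUdef
  set W := (hH'.eigenvectorUnitary : Matrix m m ℂ) with hWdef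
  have hU : Uᴴ * U = 1 := eigenvectorUnitary_conjTranspose_mul hH
  have hW : Wᴴ * W = 1 := eigenvectorUnitary_conjTranspose_mul hH'
  have hdiag (j : m) : ∑ i, Complex.normSq (Wᴴ i j) * hH'.eigenvalues i =
      (krausMap R ρ j j).re := (apply_self_eq_sum_eigenvalues hH' j).symm
  have hcol (i : m) : ∑ j, Complex.normSq (Wᴴ i j) = 1 := sum_normSq_eigenvectorUnitary hH' i
  have hin (f : n → ℝ) : ∑ k : n × n, Complex.normSq ((Uᴴ * U) k.1 k.2) * f k.1 = ∑ i, f i := by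
    rw [hU, Fintype.sum_prod_type]
    refine Finset.sum_congr rfl fun i _ => ?_
    rw [Finset.sum_eq_single i]
    · simp
    · intro j _ hj
      simp [Matrix.one_apply_ne hj.symm]
    · simp
  have hout (f : m → ℝ) :
      ∑ k : m × m, Complex.normSq ((Wᴴ * (1 : Matrix m m ℂ)) k.1 k.2) * f k.1 = ∑ i, f i := by
    rw [Matrix.mul_one, Fintype.sum_prod_type]
    simp only [← Finset.sum_mul, hcol, one_mul]
  -- The maximally mixed state is diagonal in the eigenbasis of `ρ`, and its image in the standard
  -- basis; hence `V = U` and `V' = 1`.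
  have hD := relativeEntropy_krausMap_le R hR (U := U) (V := U) (U' := W) (V' := 1)
    (p := hH.eigenvalues) (q := fun _ => (Fintype.card n : ℝ)⁻¹) (p' := hH'.eigenvalues) (q' := q)
    hU hU hW (by simp) hρ.1.eigenvalues_nonneg (fun _ => inv_pos.mpr hc)
    hΦ.1.eigenvalues_nonneg hq ?_ ?_ ?_ ?_
  · have hL : ∑ k : m × m, Complex.normSq ((Wᴴ * (1 : Matrix m m ℂ)) k.1 k.2) *
        hH'.eigenvalues k.1 * (Real.log (hH'.eigenvalues k.1) - Real.log (q k.2)) =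
        ∑ i, hH'.eigenvalues i * Real.log (hH'.eigenvalues i) -
          ∑ j, (krausMap R ρ j j).re * Real.log (q j) := by
      simp only [mul_sub, Finset.sum_sub_distrib, mul_assoc]
      rw [hout fun i => hH'.eigenvalues i * Real.log (hH'.eigenvalues i), Matrix.mul_one,
        Fintype.sum_prod_type_right]
      simp only [← mul_assoc, ← Finset.sum_mul, hdiag]
    have hRR : ∑ k : n × n, Complex.normSq ((Uᴴ * U) k.1 k.2) * hH.eigenvalues k.1 *
        (Real.log (hH.eigenvalues k.1) - Real.log (Fintype.card n : ℝ)⁻¹) =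
        ∑ i, hH.eigenvalues i * Real.log (hH.eigenvalues i) + Real.log (Fintype.card n) := by
      simp only [mul_assoc]
      rw [hin fun i => hH.eigenvalues i *
        (Real.log (hH.eigenvalues i) - Real.log (Fintype.card n : ℝ)⁻¹)]
      simp only [mul_sub, Finset.sum_sub_distrib, ← Finset.sum_mul, hsum, Real.log_inv]
      ring
    rw [hL, hRR] at hD
    rw [vonNeumannEntropy_eq_sum_eigenvalues hH, vonNeumannEntropy_eq_sum_eigenvalues hH']
    simp only [Real.logb, ← mul_div_assoc, ← Finset.sum_div]
    rw [← sub_div, ← add_div]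
    refine div_le_div_of_nonneg_right ?_ hl.le
    simp only [Real.negMulLog, neg_mul, Finset.sum_neg_distrib]
    linarith
  · intro i j hj
    -- A vanishing diagonal entry is a sum of nonnegative terms, so each term vanishes: this is the
    -- support condition.
    have h0 := hs j hj
    rw [← hdiag j, Finset.sum_eq_zero_iff_of_nonneg fun i _ =>
      mul_nonneg (Complex.normSq_nonneg _) (hΦ.1.eigenvalues_nonneg i)] at h0
    simpa using h0 i (Finset.mem_univ i)
  · rw [hUdef, hWdef, ← eq_eigenvectorUnitary_mul_diagonal hH,
      ← eq_eigenvectorUnitary_mul_diagonal hH']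
  · have hU' : U * Uᴴ = 1 := mul_eq_one_comm.mp hU
    have hd : (Matrix.diagonal fun _ : n => (((Fintype.card n : ℝ)⁻¹ : ℝ) : ℂ)) =
        ((Fintype.card n : ℝ)⁻¹ : ℂ) • (1 : Matrix n n ℂ) := by
      rw [Matrix.smul_one_eq_diagonal, Complex.ofReal_inv]
    rw [hd, Matrix.mul_smul, Matrix.mul_one, Matrix.smul_mul, hU', hmix]
    simp
  · rw [hout, hin, hsum, hsum']

end Kraus

/-! ### Complements built from Kraus operators. -/

section Complement

variable {n m ι : Type*} [DecidableEq n] [Fintype m] [Fintype ι]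

/-- The map built from the Kraus operators of a channel is a complementary channel. -/
theorem isComplementaryChannel_krausComplement [Fintype n] {K : ι → Matrix m n ℂ}
    (hK : ∑ α, (K α)ᴴ * K α = 1) : IsComplementaryChannel (krausMap K) (krausComplement K) := by
  refine ⟨Matrix.of fun i j => K i.2 i.1 j, ?_, fun ρ => ?_, fun ρ => ?_⟩
  · rw [← hK]
    ext i j
    simp only [Matrix.mul_apply, Matrix.sum_apply, Fintype.sum_prod_type_right,
      Matrix.conjTranspose_apply, Matrix.of_apply]
  · ext i j
    simp only [krausMap, partialTraceRight, Matrix.mul_apply, Matrix.sum_apply,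
      Matrix.conjTranspose_apply, Matrix.of_apply]
  · ext i j
    simp only [krausComplement, partialTraceLeft, Matrix.mul_apply, Matrix.sum_apply,
      Matrix.conjTranspose_apply, Matrix.of_apply]

theorem sum_conjTranspose_mul_krausComplement {K : ι → Matrix m n ℂ}
    (hK : ∑ α, (K α)ᴴ * K α = 1) :
    ∑ i : m, (Matrix.of fun α j => K α i j)ᴴ * (Matrix.of fun α j => K α i j) = 1 := by
  rw [← hK]
  ext i j
  simp only [Matrix.sum_apply, Matrix.mul_apply, Matrix.conjTranspose_apply, Matrix.of_apply]
  exact Finset.sum_comm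

end Complement

/-! ### The noisy Landau-Streater channel. -/

section NoisyLS

variable {x : ℝ}

theorem ofReal_sqrt_mul_self {a : ℝ} (ha : 0 ≤ a) : ((√a : ℝ) : ℂ) * ((√a : ℝ) : ℂ) = (a : ℂ) := by
  rw [← Complex.ofReal_mul, Real.mul_self_sqrt ha]

theorem sum_noisyLSKraus_conjTranspose_mul (hx0 : 0 ≤ x) (hx1 : x ≤ 1) :
    ∑ α, (noisyLSKraus x α)ᴴ * noisyLSKraus x α = 1 := by
  have ha := ofReal_sqrt_mul_self (sub_nonneg.mpr hx1)
  have hb := ofReal_sqrt_mul_self (show 0 ≤ x / 2 by linarith)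
  have hI := Complex.I_mul_I
  push_cast at ha hb
  unfold noisyLSKraus
  generalize √(x / 2) = b at *
  ext i j
  simp only [Fin.sum_univ_four, Matrix.add_apply, Matrix.mul_apply,
    Fin.sum_univ_three, Matrix.conjTranspose_apply]
  fin_cases i <;> fin_cases j <;> simp
  all_goals linear_combination ha + 2 * hb - 2 * (b : ℂ) * (b : ℂ) * hI

/-- Contracting `∑ ε_abc ε_ade = δ_bd δ_ce - δ_be δ_cd` gives `∑ J_a ρ J_a† = Tr(ρ) I - ρᵀ`. -/
theorem krausMap_noisyLSKraus (hx0 : 0 ≤ x) (hx1 : x ≤ 1) :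
    krausMap (noisyLSKraus x) = noisyLS x := by
  have ha := ofReal_sqrt_mul_self (sub_nonneg.mpr hx1)
  have hb := ofReal_sqrt_mul_self (show 0 ≤ x / 2 by linarith)
  funext ρ
  ext i j
  have key : krausMap (noisyLSKraus x) ρ i j =
      ((√(1 - x) : ℝ) : ℂ) * ((√(1 - x) : ℝ) : ℂ) * ρ i j +
        ((√(x / 2) : ℝ) : ℂ) * ((√(x / 2) : ℝ) : ℂ) *
          (ρ.trace * (1 : Matrix (Fin 3) (Fin 3) ℂ) i j - ρ j i) := by
    unfold noisyLSKraus
    generalize √(x / 2) = b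
    simp only [krausMap, Fin.sum_univ_four, Matrix.add_apply, Matrix.mul_apply,
      Fin.sum_univ_three, Matrix.conjTranspose_apply, Matrix.trace_fin_three]
    fin_cases i <;> fin_cases j <;> simp <;> ring_nf <;> simp only [Complex.I_sq] <;> ring
  rw [key, ha, hb]
  simp [noisyLS]

theorem isComplementaryChannel_noisyLSComplement (hx0 : 0 ≤ x) (hx1 : x ≤ 1) :
    IsComplementaryChannel (noisyLS x) (noisyLSComplement x) := by
  rw [← krausMap_noisyLSKraus hx0 hx1]
  exact isComplementaryChannel_krausComplement (sum_noisyLSKraus_conjTranspose_mul hx0 hx1)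

theorem noisyLSComplement_zero_zero (hx1 : x ≤ 1) (ρ : Matrix (Fin 3) (Fin 3) ℂ) :
    noisyLSComplement x ρ 0 0 = (1 - x) * ρ.trace := by
  have ha := ofReal_sqrt_mul_self (sub_nonneg.mpr hx1)
  push_cast at ha
  rw [← ha]
  simp only [noisyLSComplement, krausComplement, noisyLSKraus, Fin.sum_univ_three,
    Matrix.add_apply, Matrix.mul_apply, Matrix.conjTranspose_apply, Matrix.of_apply,
    Matrix.trace_fin_three]
  simp
  ring

/-- The diagonal entries are `Tr(K_α ρ K_α†)`, and `J_a† J_a = I - e_a e_a†`. -/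
theorem noisyLSComplement_succ_succ (hx0 : 0 ≤ x) (ρ : Matrix (Fin 3) (Fin 3) ℂ) (a : Fin 3) :
    noisyLSComplement x ρ a.succ a.succ = x / 2 * (ρ.trace - ρ a a) := by
  have hb := ofReal_sqrt_mul_self (show 0 ≤ x / 2 by linarith)
  have hI := Complex.I_mul_I
  push_cast at hb
  rw [← hb]
  simp only [noisyLSComplement, krausComplement]
  unfold noisyLSKraus
  generalize √(x / 2) = b
  simp only [Fin.sum_univ_three, Matrix.add_apply, Matrix.mul_apply, Matrix.conjTranspose_apply,
    Matrix.of_apply, Matrix.trace_fin_three]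
  fin_cases a <;> simp
  · linear_combination -(b : ℂ) * (b : ℂ) * (ρ 1 1 + ρ 2 2) * hI
  · linear_combination -(b : ℂ) * (b : ℂ) * (ρ 0 0 + ρ 2 2) * hI
  · linear_combination -(b : ℂ) * (b : ℂ) * (ρ 0 0 + ρ 1 1) * hI

theorem noisyLSComplement_maxMixed (hx0 : 0 ≤ x) (hx1 : x ≤ 1) :
    noisyLSComplement x maxMixed =
      Matrix.diagonal fun α => ((![1 - x, x / 3, x / 3, x / 3] α : ℝ) : ℂ) := by
  have htr : maxMixed.trace = 1 := by
    simp [maxMixed]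
  ext α β
  by_cases h : α = β
  · subst h
    refine Fin.cases ?_ (fun a => ?_) α
    · rw [noisyLSComplement_zero_zero hx1, htr]
      simp
    · rw [noisyLSComplement_succ_succ hx0, htr]
      fin_cases a <;> simp [maxMixed] <;> ring
  · rw [Matrix.diagonal_apply_ne _ h]
    -- At `I/3` the off-diagonal entries are multiples of `Tr(K_α K_β†)`, zero by orthogonality of
    -- `I, J_1, J_2, J_3`.
    simp only [noisyLSComplement, krausComplement, noisyLSKraus, maxMixed, Fin.sum_univ_three,
      Matrix.add_apply, Matrix.mul_apply, Matrix.conjTranspose_apply, Matrix.of_apply]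
    fin_cases α <;> fin_cases β <;> simp at h ⊢

theorem noisyLS_maxMixed (x : ℝ) : noisyLS x maxMixed = maxMixed := by
  ext i j
  fin_cases i <;> fin_cases j <;> simp [noisyLS, maxMixed] <;> ring

theorem maxMixed_eq_diagonal :
    maxMixed = Matrix.diagonal fun _ : Fin 3 => ((1 / 3 : ℝ) : ℂ) := by
  rw [maxMixed, Matrix.smul_one_eq_diagonal]
  simp

theorem isDensityMatrix_maxMixed : IsDensityMatrix maxMixed := by
  refine ⟨?_, by simp [maxMixed]⟩
  rw [maxMixed_eq_diagonal]
  refine Matrix.PosSemidef.diagonal fun i => ?_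
  simp only [Pi.zero_apply, Complex.zero_le_real]
  norm_num

theorem vonNeumannEntropy_maxMixed : vonNeumannEntropy maxMixed = Real.logb 2 3 := by
  rw [maxMixed_eq_diagonal, vonNeumannEntropy_diagonal]
  simp [Real.negMulLog, Real.logb]

theorem vonNeumannEntropy_noisyLSComplement_maxMixed (hx0 : 0 ≤ x) (hx1 : x ≤ 1) :
    vonNeumannEntropy (noisyLSComplement x maxMixed) =
      -(x * Real.logb 2 (x / 3) + (1 - x) * Real.logb 2 (1 - x)) := by
  rw [noisyLSComplement_maxMixed hx0 hx1, vonNeumannEntropy_diagonal]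
  simp only [Fin.sum_univ_four, Matrix.cons_val, Real.negMulLog, Real.logb]
  ring

theorem vonNeumannEntropy_sub_noisyLSComplement_le (hx0 : 0 ≤ x) (hx1 : x ≤ 1)
    {ρ : Matrix (Fin 3) (Fin 3) ℂ} (hρ : IsDensityMatrix ρ) :
    vonNeumannEntropy ρ - vonNeumannEntropy (noisyLSComplement x ρ) ≤
      Real.logb 2 3 + (x * Real.logb 2 (x / 3) + (1 - x) * Real.logb 2 (1 - x)) := by
  have h0 : (noisyLSComplement x ρ 0 0).re = 1 - x := by
    rw [noisyLSComplement_zero_zero hx1, hρ.2]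
    simp
  have h1 (a : Fin 3) : (noisyLSComplement x ρ a.succ a.succ).re = x / 2 * (1 - (ρ a a).re) := by
    rw [noisyLSComplement_succ_succ hx0, hρ.2,
      show (x : ℂ) / 2 * (1 - ρ a a) = ((x / 2 : ℝ) : ℂ) * (1 - ρ a a) by push_cast; ring,
      Complex.re_ofReal_mul]
    simp
  have htr : (ρ 0 0).re + (ρ 1 1).re + (ρ 2 2).re = 1 := by
    have h := congrArg Complex.re hρ.2
    rwa [Matrix.trace_fin_three] at h
  have h := vonNeumannEntropy_sub_krausMap_le
    (R := fun i : Fin 3 => Matrix.of fun α j => noisyLSKraus x α i j)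
    (q := ![1 - x, x / 3, x / 3, x / 3])
    (sum_conjTranspose_mul_krausComplement (sum_noisyLSKraus_conjTranspose_mul hx0 hx1))
    ?_ ?_ hρ ?_
  · refine h.trans_eq ?_
    change _ + ∑ j, (noisyLSComplement x ρ j j).re * _ = _
    rw [Fin.sum_univ_succ, Fin.sum_univ_three, h0, h1, h1, h1]
    simp only [Fintype.card_fin, Matrix.cons_val_zero, Matrix.cons_val_succ, Matrix.cons_val,
      Nat.cast_ofNat]
    -- The weights `(x/2)(1 - ρ_aa)` share the factor `log₂(x/3)` and sum to `x`, so `ρ` drops out.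
    linear_combination -(x / 2 * Real.logb 2 (x / 3)) * htr
  · intro j
    have hx3 : 0 ≤ x / 3 := by positivity
    fin_cases j <;> simp [hx3, hx1]
  · have hm : (((Fintype.card (Fin 3) : ℝ)⁻¹ : ℂ) • (1 : Matrix (Fin 3) (Fin 3) ℂ)) = maxMixed := by
      simp [maxMixed]
    rw [hm]
    exact noisyLSComplement_maxMixed hx0 hx1
  · change ∀ j, _ → (noisyLSComplement x ρ j j).re = 0
    -- The reference state is singular only at `x = 1` (entry `0`) or `x = 0` (the others), where
    -- the same diagonal entries of the output vanish.
    refine Fin.cases (fun h => ?_) fun a h => ?_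
    · rw [h0]
      simpa using h
    · have hx : x = 0 := by
        fin_cases a <;> simpa using h
      rw [h1, hx]
      simp

theorem noisyLS_isDensityMatrix (hx0 : 0 ≤ x) (hx1 : x ≤ 1) {ρ : Matrix (Fin 3) (Fin 3) ℂ}
    (hρ : IsDensityMatrix ρ) : IsDensityMatrix (noisyLS x ρ) := by
  rw [← krausMap_noisyLSKraus hx0 hx1]
  exact krausMap_isDensityMatrix (sum_noisyLSKraus_conjTranspose_mul hx0 hx1) hρ

end NoisyLS

end QChannel

theorem mainTheorem2 (x : ℝ) (hx0 : 0 ≤ x) (hx1 : x ≤ 1) :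
    QChannel.IsComplementaryChannel (QChannel.noisyLS x) (QChannel.noisyLSComplement x) ∧
    ∀ {E : Type*} [Fintype E] [DecidableEq E]
      (Λc : Matrix (Fin 3) (Fin 3) ℂ → Matrix E E ℂ),
      QChannel.IsComplementaryChannel (QChannel.noisyLS x) Λc →
        (QChannel.IsDensityMatrix QChannel.maxMixed ∧
          IsMaxOn (QChannel.mutualInformation (QChannel.noisyLS x) Λc)
            {ρ | QChannel.IsDensityMatrix ρ} QChannel.maxMixed) ∧
        QChannel.eaCapacity (QChannel.noisyLS x) Λc =
          QChannel.mutualInformation (QChannel.noisyLS x) Λc QChannel.maxMixed ∧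
        QChannel.eaCapacity (QChannel.noisyLS x) Λc =
          2 * Real.logb 2 3 + x * Real.logb 2 (x / 3) + (1 - x) * Real.logb 2 (1 - x) := by
  have hcan := QChannel.isComplementaryChannel_noisyLSComplement hx0 hx1
  refine ⟨hcan, fun Λc hΛc => ?_⟩
  have hval : QChannel.mutualInformation (QChannel.noisyLS x) Λc QChannel.maxMixed =
      2 * Real.logb 2 3 + x * Real.logb 2 (x / 3) + (1 - x) * Real.logb 2 (1 - x) := by
    rw [QChannel.mutualInformation, QChannel.noisyLS_maxMixed,
      hΛc.vonNeumannEntropy_eq hcan QChannel.isDensityMatrix_maxMixed.1,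
      QChannel.vonNeumannEntropy_maxMixed,
      QChannel.vonNeumannEntropy_noisyLSComplement_maxMixed hx0 hx1]
    ring
  have hmax : IsMaxOn (QChannel.mutualInformation (QChannel.noisyLS x) Λc)
      {ρ | QChannel.IsDensityMatrix ρ} QChannel.maxMixed := by
    intro ρ hρ
    rw [Set.mem_ofPred_eq] at hρ ⊢
    rw [hval, QChannel.mutualInformation, hΛc.vonNeumannEntropy_eq hcan hρ.1]
    -- The bounds `h1` and `h2` add up to exactly the value at `I/3`.
    have h1 := QChannel.vonNeumannEntropy_le_logb_card
      (QChannel.noisyLS_isDensityMatrix hx0 hx1 hρ)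
    have h2 := QChannel.vonNeumannEntropy_sub_noisyLSComplement_le hx0 hx1 hρ
    rw [Fintype.card_fin, Nat.cast_ofNat] at h1
    linarith
  have hcap : QChannel.eaCapacity (QChannel.noisyLS x) Λc =
      QChannel.mutualInformation (QChannel.noisyLS x) Λc QChannel.maxMixed :=
    IsGreatest.csSup_eq ⟨Set.mem_image_of_mem _ QChannel.isDensityMatrix_maxMixed,
      Set.forall_mem_image.mpr fun _ hρ => hmax hρ⟩
  exact ⟨⟨QChannel.isDensityMatrix_maxMixed, hmax⟩, hcap, hcap.trans hval⟩
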